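/- Let $1\le M<K$ be integers. An instance of the hinted heterogeneous multi-agent bandit with $M$ agents and $K$ arms is a matrix $\mu\in[0,1]^{M\times K}$. In each round $t=1,\dots,T$ fresh independent rewards $X_{m,k}(t)\sim\mathrm{Bernoulli}(\mu_{m,k})$ are realized; every agent $m$ pulls one arm $k_m(t)$, and may in addition query a hint for one arm. The pulled arms form the graph $G(t)=(k_m(t))_m\in\mathcal G=[K]^{M}$. Agent $m$ receives and observes $X_{m,k_m(t)}(t)$ if no other agent pulls the same arm, and $0$ otherwise; a hint for arm $k$ reveals $X_{m,k}(t)$. A policy $\pi$ is a (possibly randomized) rule that chooses the pulls and hint queries of each round from all earlier decisions and observations; it may know the horizon $T$. For $G=(k^G_m)_m\in\mathcal G$ let $$U(G;\mu)=\sum_{m}\mu_{m,k^G_m}\,\mathbf 1\{k^G_{m'}\ne k^G_m\ \text{for all}\ m'\ne m\},$$ and let $G^*=G^*(\mu)$ be the maximizer of $U(\cdot\,;\mu)$ on $\mathcal G$ when it is unique. Write $$R^\pi(T)=\sum_{t=1}^T\bigl(U(G^*;\mu)-\mathbb E_\mu[U(G(t);\mu)]\bigr),$$ $L^\pi(T)$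 for the expected total number of hint queries of all agents in the first $T$ rounds, and $N^\pi_G(T)$ for the number of rounds $t\le T$ with $G(t)=G$. Call $\pi$ uniformly fast convergent if for every instance $\mu$ with a unique optimal $G^*$, every $G\in\mathcal G$ with $G\neq G^*$ and every $\alpha\in(0,1)$, $\mathbb E_\mu[N^\pi_G(T)]=o(T^\alpha)$ as $T\to\infty$. Theorem. Let $\pi$ be a uniformly fast convergent policy, and let $\mu$ be an instance with a unique optimal $G^*$ and with $U(G^*;\mu)<M$ (that is, not all $M$ rewards of the optimal matching are almost surely equal to $1$). If $\pi$ has time-independent regret on $\mu$, i.e. $\sup_T R^\pi(T)<\infty$, then $L^\pi(T)=\Omega(\log T)$ on $\mu$: there is a constant $c>0$ with $L^\pi(T)\ge c\log T$ for all sufficiently large $T$. -/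

import Mathlib

open scoped ENNReal

namespace HMA2B

/-- The graphs of the model: every agent is joined to exactly one arm. Two agents may share an arm,
in which case they collide. -/
abbrev Matching (M K : ℕ) := Fin M → Fin K

/-- An instance: the matrix of Bernoulli means, with entries in `[0, 1]`. -/
abbrev Instance (M K : ℕ) := Fin M → Fin K → unitInterval

/-- Agent `m` is alone on its arm. -/
def NoCollision {M K : ℕ} (G : Matching M K) (m : Fin M) : Prop :=
  ∀ m', m' ≠ m → G m' ≠ G m

instance {M K : ℕ} (G : Matching M K) (m : Fin M) : Decidable (NoCollision G m) := by
  unfold NoCollision; infer_instance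

/-- The expected utility `U(G; μ)`. -/
noncomputable def utility {M K : ℕ} (μ : Instance M K) (G : Matching M K) : ℝ :=
  ∑ m, if NoCollision G m then (μ m (G m) : ℝ) else 0

/-- `G` is the unique maximizer of the utility among all graphs. -/
def IsUniqueOptimal {M K : ℕ} (μ : Instance M K) (G : Matching M K) : Prop :=
  ∀ G', G' ≠ G → utility μ G' < utility μ G

/-- The reward realizations `X_{m,k}` of one round. -/
abbrev RewardTable (M K : ℕ) := Fin M → Fin K → Bool

/-- Probability of one Bernoulli outcome. -/
noncomputable def bernoulliMass (p : unitInterval) (b : Bool) : ℝ≥0∞ :=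
  if b then ENNReal.ofReal (p : ℝ) else ENNReal.ofReal (1 - (p : ℝ))

theorem sum_bernoulliMass (p : unitInterval) : ∑ b, bernoulliMass p b = 1 := by
  simp only [bernoulliMass, Fintype.sum_bool, if_true, Bool.false_eq_true, if_false]
  rw [← ENNReal.ofReal_add p.2.1 (sub_nonneg.2 p.2.2)]
  simp

theorem sum_tableMass {M K : ℕ} (μ : Instance M K) :
    ∑ x : RewardTable M K, ∏ m, ∏ k, bernoulliMass (μ m k) (x m k) = 1 := by
  rw [← Fintype.prod_sum (fun m (y : Fin K → Bool) => ∏ k, bernoulliMass (μ m k) (y k))]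
  refine Finset.prod_eq_one fun m _ => ?_
  rw [← Fintype.prod_sum (fun k b => bernoulliMass (μ m k) b)]
  exact Finset.prod_eq_one fun k _ => sum_bernoulliMass _

/-- Law of the reward realizations of one round: independent Bernoulli variables. -/
noncomputable def tableLaw {M K : ℕ} (μ : Instance M K) : PMF (RewardTable M K) :=
  PMF.ofFintype (fun x => ∏ m, ∏ k, bernoulliMass (μ m k) (x m k)) (sum_tableMass μ)

/-- The decisions of one round: the graph of pulled arms and, for each agent, either no query
(`none`) or the arm for which a hint is queried. -/
abbrev Action (M K : ℕ) := Matching M K × (Fin M → Option (Fin K))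

/-- What is observed in one round: the collected rewards, and the queried hints. -/
abbrev Feedback (M : ℕ) := (Fin M → Bool) × (Fin M → Option Bool)

/-- A colliding agent receives reward zero; a hint reveals the realization of the queried arm. -/
def feedback {M K : ℕ} (a : Action M K) (x : RewardTable M K) : Feedback M :=
  (fun m => if NoCollision a.1 m then x m (a.1 m) else false,
   fun m => (a.2 m).map (x m))

/-- The decisions and observations of the first `t` rounds. -/
abbrev History (M K t : ℕ) := Fin t → Action M K × Feedback M

/-- A (randomized) policy: `π T t h` is the law of the decisions in the round that follows the
history `h` of `t` rounds, when the horizon is `T`. A policy that does not use the horizon is one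
that ignores its first argument; policies without a central decision maker, in which every agent
only uses what it has seen itself, are special cases. -/
abbrev Policy (M K : ℕ) := ℕ → ∀ t : ℕ, History M K t → PMF (Action M K)

/-- Law of the history of the first `t` rounds, for the horizon `T`. Each round draws the decisions
from the policy and, independently of everything before, a fresh table of rewards. -/
noncomputable def historyLaw {M K : ℕ} (μ : Instance M K) (π : Policy M K) (T : ℕ) :
    ∀ t : ℕ, PMF (History M K t)
  | 0 => PMF.pure Fin.elim0
  | t + 1 => (historyLaw μ π T t).bind fun h =>
      (π T t h).bind fun a =>
        (tableLaw μ).map fun x =>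
          Fin.snoc (α := fun _ : Fin (t + 1) => Action M K × Feedback M) h (a, feedback a x)

/-- Expectation under the policy of a function of the whole history up to the horizon `T`. -/
noncomputable def expectation {M K : ℕ} (μ : Instance M K) (π : Policy M K) (T : ℕ)
    (f : History M K T → ℝ) : ℝ :=
  ∑ h, (historyLaw μ π T T h).toReal * f h

/-- `N_G`: the number of rounds in which `G` is the graph of pulled arms. -/
def pullCount {M K T : ℕ} (G : Matching M K) (h : History M K T) : ℕ :=
  (Finset.univ.filter fun t => (h t).1.1 = G).card

/-- The number of hint queries, over all agents and rounds. -/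
def hintCount {M K T : ℕ} (h : History M K T) : ℕ :=
  ∑ m : Fin M, ∑ t : Fin T, if ((h t).1.2 m).isSome then 1 else 0

/-- Hint complexity `L^π(T)`. -/
noncomputable def hintComplexity {M K : ℕ} (μ : Instance M K) (π : Policy M K) (T : ℕ) : ℝ :=
  expectation μ π T fun h => (hintCount h : ℝ)

/-- Regret `R^π(T)` with respect to the optimal matching `Gstar`. -/
noncomputable def regret {M K : ℕ} (μ : Instance M K) (Gstar : Matching M K) (π : Policy M K)
    (T : ℕ) : ℝ :=
  ∑ t : Fin T, (utility μ Gstar - expectation μ π T fun h => utility μ (h t).1.1)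

/-- On every instance with a unique optimal matching, every other graph is pulled `o(T ^ α)` times
in expectation, for every `0 < α < 1`. -/
def UniformlyFastConvergent {M K : ℕ} (π : Policy M K) : Prop :=
  ∀ (μ : Instance M K) (Gstar : Matching M K), IsUniqueOptimal μ Gstar →
    ∀ α : ℝ, 0 < α → α < 1 → ∀ G, G ≠ Gstar →
      (fun T : ℕ => expectation μ π T fun h => (pullCount G h : ℝ))
        =o[Filter.atTop] fun T : ℕ => (T : ℝ) ^ α

/-- On the instance `μ` the regret is bounded in the horizon. -/
def TimeIndependentRegret {M K : ℕ} (μ : Instance M K) (Gstar : Matching M K)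
    (π : Policy M K) : Prop :=
  ∃ C : ℝ, ∀ T : ℕ, regret μ Gstar π T ≤ C

end HMA2B

/-! Some arm is free in the optimal `Gstar`, so optimality forces every agent to be alone on an arm
of positive mean. Raising one agent's mean on the free arm and lowering the other means off `Gstar`
gives `ν`, which agrees with `μ` along `Gstar` but has another optimum
(`exists_confusing_instance`). A round that pulls `Gstar` without hints has the same feedback law
under both. Any other round changes likelihoods by a factor at most `C`, so the information is at
most `log C` times the hints plus the rounds off `Gstar` (`mean_log_historyLaw_le`). Bounded regret
bounds the latter in expectation, while fast convergence makes pulls of `Gstar` rare under `ν`.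
Testing with `log (1 + N / √T)`, `N` the number of pulls of `Gstar`, shows that order `log T`
information is needed (`log_le_of_pullCount`), and only hints can supply it. -/

namespace HMA2B

/-! ### Means under finitely supported laws -/

section Mean

variable {α β : Type*} [Fintype α] [Fintype β]

/-- The mean of a real function under a law on a finite type. -/
noncomputable def mean (p : PMF α) (f : α → ℝ) : ℝ := ∑ a, (p a).toReal * f a

theorem sum_toReal (p : PMF α) : ∑ a, (p a).toReal = 1 := by
  have h := p.tsum_coe
  rw [tsum_fintype] at h
  rw [← ENNReal.toReal_sum fun a _ => p.apply_ne_top a, h, ENNReal.toReal_one]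

theorem mean_const (p : PMF α) (c : ℝ) : mean p (fun _ => c) = c := by
  rw [mean, ← Finset.sum_mul, sum_toReal, one_mul]

theorem mean_add (p : PMF α) (f g : α → ℝ) :
    mean p (fun a => f a + g a) = mean p f + mean p g := by
  simp only [mean, mul_add, Finset.sum_add_distrib]

theorem mean_const_mul (p : PMF α) (c : ℝ) (f : α → ℝ) :
    mean p (fun a => c * f a) = c * mean p f := by
  simp only [mean, Finset.mul_sum, mul_left_comm]

theorem mean_mono (p : PMF α) {f g : α → ℝ} (h : ∀ a, f a ≤ g a) : mean p f ≤ mean p g :=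
  Finset.sum_le_sum fun a _ => mul_le_mul_of_nonneg_left (h a) ENNReal.toReal_nonneg

theorem mean_pos (p : PMF α) {f : α → ℝ} (h : ∀ a, 0 < f a) : 0 < mean p f := by
  obtain ⟨a, ha⟩ := p.support_nonempty
  refine Finset.sum_pos' (fun b _ => mul_nonneg ENNReal.toReal_nonneg (h b).le)
    ⟨a, Finset.mem_univ a, mul_pos (ENNReal.toReal_pos ?_ (p.apply_ne_top a)) (h a)⟩
  exact (p.mem_support_iff a).1 ha

theorem mean_bind (p : PMF α) (q : α → PMF β) (f : β → ℝ) :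
    mean (p.bind q) f = mean p fun a => mean (q a) f := by
  have key : ∀ b, ((p.bind q) b).toReal = ∑ a, (p a).toReal * (q a b).toReal := fun b => by
    rw [PMF.bind_apply, tsum_fintype, ENNReal.toReal_sum]
    · simp only [ENNReal.toReal_mul]
    · exact fun a _ => ENNReal.mul_ne_top (p.apply_ne_top a) ((q a).apply_ne_top b)
  simp only [mean, key, Finset.sum_mul, Finset.mul_sum, mul_assoc]
  exact Finset.sum_comm

theorem mean_pure (a : α) (f : α → ℝ) : mean (PMF.pure a) f = f a := by
  classical
  rw [mean, Finset.sum_eq_single a]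
  · simp
  · intro b _ hb
    simp [PMF.pure_apply, hb]
  · simp

theorem mean_map (p : PMF α) (g : α → β) (f : β → ℝ) :
    mean (p.map g) f = mean p fun a => f (g a) := by
  rw [PMF.map, mean_bind]
  simp only [Function.comp_apply, mean_pure]

/-- Jensen's inequality for the logarithm. -/
theorem mean_log_le (p : PMF α) {f : α → ℝ} (h : ∀ a, 0 < f a) :
    mean p (fun a => Real.log (f a)) ≤ Real.log (mean p f) :=
  strictConcaveOn_log_Ioi.concaveOn.le_map_sum (fun _ _ => ENNReal.toReal_nonneg) (sum_toReal p)
    fun a _ => h a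

theorem exists_le_mul_of_support_subset (p q : PMF α) (h : ∀ a, q a = 0 → p a = 0) :
    ∃ C : ℝ, 1 < C ∧ ∀ a, (p a).toReal ≤ C * (q a).toReal := by
  have hnn : ∀ a, 0 ≤ (p a).toReal / (q a).toReal := fun a => by positivity
  -- The summand 2 forces `1 < C`, so that `log C` is positive.
  refine ⟨2 + ∑ a, (p a).toReal / (q a).toReal, ?_, fun a => ?_⟩
  · linarith [Finset.sum_nonneg fun a (_ : a ∈ Finset.univ) => hnn a]
  · by_cases hq : q a = 0
    · simp [hq, h a hq]
    · have hq' : 0 < (q a).toReal := ENNReal.toReal_pos hq (q.apply_ne_top a)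
      rw [← div_le_iff₀ hq']
      linarith [Finset.single_le_sum (fun a _ => hnn a) (Finset.mem_univ a)]

theorem mean_le_mul_mean {p q : PMF α} {C : ℝ} (h : ∀ a, (p a).toReal ≤ C * (q a).toReal)
    {f : α → ℝ} (hf : ∀ a, 0 ≤ f a) : mean p f ≤ C * mean q f := by
  rw [mean, mean, Finset.mul_sum]
  exact Finset.sum_le_sum fun a _ =>
    (mul_le_mul_of_nonneg_right (h a) (hf a)).trans_eq (mul_assoc _ _ _)

end Mean

variable {M K : ℕ}

theorem expectation_eq_mean (μ : Instance M K) (π : Policy M K) (T : ℕ)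
    (f : History M K T → ℝ) : expectation μ π T f = mean (historyLaw μ π T T) f := rfl

/-! ### The law of one round -/

/-- The marginal law of the rewards along `G`. -/
theorem sum_tableMass_of_eq (μ : Instance M K) (G : Matching M K) (y : Fin M → Bool) :
    (∑ x : RewardTable M K, if (∀ m, x m (G m) = y m) then
      ∏ m, ∏ k, bernoulliMass (μ m k) (x m k) else 0) = ∏ m, bernoulliMass (μ m (G m)) (y m) := by
  have row : ∀ m, (∑ r : Fin K → Bool, if r (G m) = y m then
      ∏ k, bernoulliMass (μ m k) (r k) else 0) = bernoulliMass (μ m (G m)) (y m) := fun m => by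
    -- The constraint on arm `G m` is moved into the product over arms, so that the sum factorizes.
    have h1 : ∀ r : Fin K → Bool, (if r (G m) = y m then
        ∏ k, bernoulliMass (μ m k) (r k) else 0) =
        ∏ k, if k = G m → r k = y m then bernoulliMass (μ m k) (r k) else 0 := fun r => by
      rw [Finset.prod_ite_zero]
      simp
    simp only [h1]
    rw [← Fintype.prod_sum fun k b =>
      if k = G m → b = y m then bernoulliMass (μ m k) b else 0]
    rw [Finset.prod_eq_single (G m)]
    · simp
    · intro k _ hk
      simpa [hk] using sum_bernoulliMass (μ m k)
    · simp
  rw [← Finset.prod_congr rfl fun m _ => row m, Fintype.prod_sum fun m (r : Fin K → Bool) =>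
    if r (G m) = y m then ∏ k, bernoulliMass (μ m k) (r k) else 0]
  refine Finset.sum_congr rfl fun x _ => ?_
  rw [Finset.prod_ite_zero]
  simp

theorem map_tableLaw_apply (μ : Instance M K) (G : Matching M K) (y : Fin M → Bool) :
    (tableLaw μ).map (fun x m => x m (G m)) y = ∏ m, bernoulliMass (μ m (G m)) (y m) := by
  rw [← sum_tableMass_of_eq, PMF.map_apply, tsum_fintype]
  refine Finset.sum_congr rfl fun x _ => ?_
  simp only [tableLaw, PMF.ofFintype_apply, funext_iff, eq_comm]

/-- If two instances agree along `G`, pulling `G` without hints gives the same feedback law. -/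
theorem mean_feedback_eq {μ ν : Instance M K} {G : Matching M K}
    (h : ∀ m, ν m (G m) = μ m (G m)) (a : Action M K) (ha : a.1 = G) (ha' : ∀ m, a.2 m = none)
    (φ : Feedback M → ℝ) :
    mean (tableLaw μ) (fun x => φ (feedback a x)) =
      mean (tableLaw ν) fun x => φ (feedback a x) := by
  obtain ⟨a1, a2⟩ := a
  subst ha
  have hf : ∀ x : RewardTable M K, feedback (a1, a2) x =
      (fun y : Fin M → Bool => ((fun m => if NoCollision a1 m then y m else false,
        fun _ => none) : Feedback M)) (fun m => x m (a1 m)) := fun x => by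
    simp only [feedback]
    congr 1
    funext m
    rw [show a2 m = none from ha' m]
    rfl
  have hl : (tableLaw μ).map (fun x m => x m (a1 m)) = (tableLaw ν).map fun x m => x m (a1 m) := by
    ext y
    simp only [map_tableLaw_apply, h]
  have hm := congrArg (fun p => mean p fun y : Fin M → Bool =>
    φ (fun m => if NoCollision a1 m then y m else false, fun _ => none)) hl
  simpa only [hf, mean_map] using hm

/-- The number of hints queried in one round. -/
def actionHints (a : Action M K) : ℕ := ∑ m, if (a.2 m).isSome then 1 else 0

/-- A bound on the information that one round carries: the number of hints, and one more if
the graph is not `G`. -/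
def roundCost (G : Matching M K) (a : Action M K) : ℕ :=
  (if a.1 = G then 0 else 1) + actionHints a

/-- At zero cost the two feedback laws coincide and Jensen suffices. Otherwise the density bound
loses one `log C`, which the cost, being at least 1, pays for. -/
theorem mean_log_feedback_le {μ ν : Instance M K} {G : Matching M K} {C : ℝ} (hC : 1 < C)
    (h : ∀ m, ν m (G m) = μ m (G m))
    (hle : ∀ x, (tableLaw μ x).toReal ≤ C * (tableLaw ν x).toReal)
    (a : Action M K) {φ : Feedback M → ℝ} (hφ : ∀ y, 0 < φ y) :
    mean (tableLaw μ) (fun x => Real.log (φ (feedback a x))) ≤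
      Real.log (mean (tableLaw ν) fun x => φ (feedback a x)) + Real.log C * roundCost G a := by
  have hlog : 0 < Real.log C := Real.log_pos hC
  have hj := mean_log_le (tableLaw μ) fun x => hφ (feedback a x)
  by_cases hc : roundCost G a = 0
  · obtain ⟨h1, h2⟩ := Nat.add_eq_zero_iff.1 hc
    have h1' : a.1 = G := by by_contra hne; simp [hne] at h1
    have h2' : ∀ m, a.2 m = none := by simpa [actionHints] using h2
    rw [mean_feedback_eq h a h1' h2'] at hj
    simpa [hc, mean_feedback_eq h a h1' h2'] using hj
  · have hc' : (1 : ℝ) ≤ roundCost G a := by exact_mod_cast Nat.one_le_iff_ne_zero.2 hc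
    have hν := mean_pos (tableLaw ν) fun x => hφ (feedback a x)
    refine hj.trans ((Real.log_le_log (mean_pos _ fun x => hφ _)
      (mean_le_mul_mean hle fun x => (hφ _).le)).trans ?_)
    rw [Real.log_mul (by linarith) hν.ne']
    nlinarith

/-! ### Change of measure along histories -/

/-- The total of `roundCost` over a history. -/
def historyCost {t : ℕ} (G : Matching M K) (h : History M K t) : ℕ :=
  ∑ s, roundCost G (h s).1

theorem mean_historyLaw_succ (μ : Instance M K) (π : Policy M K) (T t : ℕ)
    (f : History M K (t + 1) → ℝ) :
    mean (historyLaw μ π T (t + 1)) f =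
      mean (historyLaw μ π T t) fun h => mean (π T t h) fun a => mean (tableLaw μ) fun x =>
        f (Fin.snoc (α := fun _ : Fin (t + 1) => Action M K × Feedback M) h (a, feedback a x)) := by
  rw [historyLaw]
  simp only [mean_bind, mean_map]

theorem historyCost_snoc {t : ℕ} (G : Matching M K) (h : History M K t)
    (b : Action M K × Feedback M) :
    historyCost G (Fin.snoc (α := fun _ : Fin (t + 1) => Action M K × Feedback M) h b) =
      historyCost G h + roundCost G b.1 := by
  simp [historyCost, Fin.sum_univ_castSucc]

/-- Change of measure (a Donsker–Varadhan inequality) between two instances that agree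
along `G`. -/
theorem mean_log_historyLaw_le {μ ν : Instance M K} {G : Matching M K} {C : ℝ} (hC : 1 < C)
    (h : ∀ m, ν m (G m) = μ m (G m))
    (hle : ∀ x, (tableLaw μ x).toReal ≤ C * (tableLaw ν x).toReal)
    (π : Policy M K) (T t : ℕ) (g : History M K t → ℝ) (hg : ∀ y, 0 < g y) :
    mean (historyLaw μ π T t) (fun y => Real.log (g y)) ≤
      Real.log (mean (historyLaw ν π T t) g) +
        Real.log C * mean (historyLaw μ π T t) fun y => (historyCost G y : ℝ) := by
  induction t with
  | zero =>
    simp [historyLaw, mean_pure, historyCost]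
  | succ t ih =>
    simp only [mean_historyLaw_succ, historyCost_snoc, Nat.cast_add, mean_add, mean_const]
    -- The induction hypothesis is applied to the conditional `ν`-mean of `g` over the last round.
    refine le_trans ?_ ((add_le_add_left (ih _ fun y => mean_pos _ fun a => mean_pos _ fun x =>
      hg _) (Real.log C * mean (historyLaw μ π T t) fun y =>
        mean (π T t y) fun a => (roundCost G a : ℝ))).trans_eq (by ring))
    rw [← mean_const_mul, ← mean_add]
    refine mean_mono _ fun y => ?_
    refine le_trans (mean_mono _ fun a => mean_log_feedback_le hC h hle a
      (φ := fun z => g (Fin.snoc (α := fun _ : Fin (t + 1) => Action M K × Feedback M) y (a, z)))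
      fun z => hg _) ?_
    rw [mean_add, mean_const_mul]
    gcongr
    exact mean_log_le _ fun a => mean_pos _ fun x => hg _

/-! ### Regret and the number of suboptimal rounds -/

theorem pullCount_eq_sum {T : ℕ} (G : Matching M K) (h : History M K T) :
    (pullCount G h : ℝ) = ∑ t, if (h t).1.1 = G then (1 : ℝ) else 0 := by
  simp [pullCount]

theorem historyCost_eq {T : ℕ} (G : Matching M K) (h : History M K T) :
    (historyCost G h : ℝ) = (T - pullCount G h) + hintCount h := by
  have h1 : ∑ s, actionHints (h s).1 = hintCount h := by
    simp only [actionHints, hintCount]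
    exact Finset.sum_comm
  have h2 : ∀ s, (if (h s).1.1 = G then (0 : ℝ) else 1) =
      1 - if (h s).1.1 = G then (1 : ℝ) else 0 := fun s => by split_ifs <;> simp
  rw [← h1, pullCount_eq_sum, historyCost]
  push_cast [roundCost]
  rw [Finset.sum_add_distrib]
  congr 1
  simp [h2]

theorem exists_gap {μ : Instance M K} {G : Matching M K} (hG : IsUniqueOptimal μ G) :
    ∃ Δ : ℝ, 0 < Δ ∧ ∀ G', G' ≠ G → Δ ≤ utility μ G - utility μ G' := by
  by_cases hne : ((Finset.univ : Finset (Matching M K)).erase G).Nonempty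
  · obtain ⟨G₀, h₀, hmin⟩ := Finset.exists_min_image _ (fun G' => utility μ G - utility μ G') hne
    exact ⟨_, sub_pos.2 (hG G₀ (Finset.ne_of_mem_erase h₀)), fun G' h' =>
      hmin G' (Finset.mem_erase.2 ⟨h', Finset.mem_univ _⟩)⟩
  · exact ⟨1, one_pos, fun G' h' =>
      (hne ⟨G', Finset.mem_erase.2 ⟨h', Finset.mem_univ _⟩⟩).elim⟩

/-- Each round off `G` loses at least `Δ`, so bounded regret bounds their expected number. -/
theorem gap_mul_le_regret {μ : Instance M K} {G : Matching M K} {Δ : ℝ}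
    (hΔ : ∀ G', G' ≠ G → Δ ≤ utility μ G - utility μ G') (π : Policy M K) (T : ℕ) :
    Δ * (T - mean (historyLaw μ π T T) fun h => (pullCount G h : ℝ)) ≤ regret μ G π T := by
  have h1 : regret μ G π T = mean (historyLaw μ π T T) fun h =>
      ∑ t, (utility μ G - utility μ (h t).1.1) := by
    simp only [regret, expectation, mean, Finset.sum_sub_distrib, mul_sub, Finset.mul_sum]
    rw [Finset.sum_comm (s := (Finset.univ : Finset (History M K T)))]
    congr 1
    · simp only [← Finset.sum_mul, sum_toReal, one_mul]
    · exact Finset.sum_comm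
  have h2 : (T - mean (historyLaw μ π T T) fun h => (pullCount G h : ℝ)) =
      mean (historyLaw μ π T T) fun h => ((T : ℝ) - pullCount G h) := by
    simp only [sub_eq_add_neg, mean_add, mean_const]
    simp [mean]
  rw [h1, h2, ← mean_const_mul]
  refine mean_mono _ fun h => ?_
  have h3 : ((T : ℝ) - pullCount G h) = ∑ t, (1 - if (h t).1.1 = G then (1 : ℝ) else 0) := by
    simp [pullCount_eq_sum]
  rw [h3, Finset.mul_sum]
  refine Finset.sum_le_sum fun t _ => ?_
  by_cases ht : (h t).1.1 = G
  · simp [ht]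
  · simpa [ht] using hΔ _ ht

theorem pullCount_le {T : ℕ} (G : Matching M K) (h : History M K T) : pullCount G h ≤ T := by
  simpa [pullCount] using Finset.card_filter_le (Finset.univ : Finset (Fin T)) _

/-! ### The confusing instance -/

theorem exists_free_arm (hMK : M < K) (G : Matching M K) : ∃ k, ∀ m, G m ≠ k := by
  by_contra! hcon
  have := Fintype.card_le_of_surjective G hcon
  simp at this
  omega

/-- Moving to a free arm creates no collision and can only remove some, so only the mover's own
reward needs comparing. -/
theorem utility_le_utility_update (μ : Instance M K) (G : Matching M K) {m₀ : Fin M} {k : Fin K}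
    (hk : ∀ m, G m ≠ k) (h : ¬ NoCollision G m₀ ∨ μ m₀ (G m₀) ≤ μ m₀ k) :
    utility μ G ≤ utility μ (Function.update G m₀ k) := by
  refine Finset.sum_le_sum fun m _ => ?_
  by_cases hm : m = m₀
  · subst hm
    have hnc : NoCollision (Function.update G m k) m := fun m' hm' => by
      simpa [Function.update_of_ne hm'] using hk m'
    rw [if_pos hnc, Function.update_self]
    split_ifs with hc
    · exact_mod_cast h.resolve_left (not_not.2 hc)
    · exact (μ m k).2.1
  · rw [Function.update_of_ne hm]
    by_cases hc : NoCollision G m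
    · have hnc : NoCollision (Function.update G m₀ k) m := fun m' hm' => by
        rw [Function.update_of_ne hm]
        by_cases h' : m' = m₀
        · subst h'
          simpa using (hk m).symm
        · simpa [Function.update_of_ne h'] using hc m' hm'
      rw [if_pos hc, if_pos hnc]
    · rw [if_neg hc]
      split_ifs
      · exact (μ m (G m)).2.1
      · rfl

/-- If some arm is free, a unique optimal graph has no collision and every agent strictly prefers
its arm to the free one. -/
theorem IsUniqueOptimal.noCollision_and_lt {μ : Instance M K} {G : Matching M K}
    (hG : IsUniqueOptimal μ G) {k : Fin K} (hk : ∀ m, G m ≠ k) (m : Fin M) :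
    NoCollision G m ∧ μ m k < μ m (G m) := by
  have hne : Function.update G m k ≠ G := fun h => hk m (by rw [← h]; simp)
  by_contra hcon
  refine (hG _ hne).not_ge (utility_le_utility_update μ G hk ?_)
  by_cases hc : NoCollision G m
  · exact Or.inr (not_lt.1 fun hlt => hcon ⟨hc, hlt⟩)
  · exact Or.inl hc

/-- If every agent strictly prefers the arm it has in the collision-free graph `G`, then `G` is
the unique optimum. -/
theorem isUniqueOptimal_of_forall_lt {μ : Instance M K} {G : Matching M K}
    (hc : ∀ m, NoCollision G m) (hpos : ∀ m, 0 < μ m (G m))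
    (h : ∀ m k, k ≠ G m → μ m k < μ m (G m)) : IsUniqueOptimal μ G := by
  intro G' hne
  obtain ⟨m₀, hm₀⟩ := Function.ne_iff.1 hne
  refine Finset.sum_lt_sum (fun m _ => ?_) ⟨m₀, Finset.mem_univ _, ?_⟩
  · rw [if_pos (hc m)]
    split_ifs
    · by_cases he : G' m = G m
      · rw [he]
      · exact_mod_cast (h m _ he).le
    · exact (μ m (G m)).2.1
  · rw [if_pos (hc m₀)]
    split_ifs
    · exact_mod_cast h m₀ _ hm₀
    · exact_mod_cast hpos m₀

theorem bernoulliMass_ne_zero {p : unitInterval} (h0 : 0 < (p : ℝ)) (h1 : (p : ℝ) < 1) (b : Bool) :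
    bernoulliMass p b ≠ 0 := by
  cases b <;> simp [bernoulliMass, h0, h1]

/-- Absolute continuity, which yields the constant `C` even if `μ` has entries 0 or 1. -/
theorem tableLaw_eq_zero_of_eq_zero {μ ν : Instance M K}
    (h : ∀ m k, ν m k = μ m k ∨ (0 < (ν m k : ℝ) ∧ (ν m k : ℝ) < 1)) (x : RewardTable M K)
    (hx : tableLaw ν x = 0) : tableLaw μ x = 0 := by
  simp only [tableLaw, PMF.ofFintype_apply, Finset.prod_eq_zero_iff, Finset.mem_univ,
    true_and] at hx ⊢
  obtain ⟨m, k, hmk⟩ := hx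
  refine ⟨m, k, ?_⟩
  rcases h m k with he | ⟨h0, h1⟩
  · rwa [← he]
  · exact (bernoulliMass_ne_zero h0 h1 _ hmk).elim

/-- An instance that agrees with `μ` along the optimal graph `G`, is nondegenerate elsewhere,
and has another unique optimum. -/
theorem exists_confusing_instance (hMK : M < K) {μ : Instance M K} {G : Matching M K}
    (hG : IsUniqueOptimal μ G) (hU : utility μ G < M) :
    ∃ (ν : Instance M K) (G' : Matching M K), IsUniqueOptimal ν G' ∧ G ≠ G' ∧
      (∀ m, ν m (G m) = μ m (G m)) ∧
      ∀ m k, ν m k = μ m k ∨ (0 < (ν m k : ℝ) ∧ (ν m k : ℝ) < 1) := by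
  obtain ⟨k₀, hk₀⟩ := exists_free_arm hMK G
  have hc : ∀ m, NoCollision G m := fun m => (hG.noCollision_and_lt hk₀ m).1
  have hpos : ∀ m, 0 < (μ m (G m) : ℝ) := fun m =>
    lt_of_le_of_lt (μ m k₀).2.1 (hG.noCollision_and_lt hk₀ m).2
  have hle : ∀ m, (μ m (G m) : ℝ) ≤ 1 := fun m => (μ m (G m)).2.2
  obtain ⟨m₀, hm₀⟩ : ∃ m, (μ m (G m) : ℝ) < 1 := by
    by_contra! hcon
    refine hU.not_ge ?_
    calc (M : ℝ) = ∑ _m : Fin M, (1 : ℝ) := by simp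
      _ ≤ utility μ G := Finset.sum_le_sum fun m _ => by rw [if_pos (hc m)]; exact hcon m
  -- Since `μ m₀ (G m₀) < 1`, the midpoint with 1 beats it and stays below 1; halving makes all
  -- other arms off `G` inferior yet nondegenerate.
  let v : Fin M → Fin K → ℝ := fun m k =>
    if k = G m then μ m (G m) else
      if m = m₀ ∧ k = k₀ then (1 + μ m (G m)) / 2 else μ m (G m) / 2
  have hv : ∀ m k, v m k ∈ unitInterval := fun m k => by
    have := hpos m
    have := hle m
    simp only [v]
    split_ifs <;> constructor <;> linarith
  have hk0 : k₀ ≠ G m₀ := (hk₀ m₀).symm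
  have hvG : ∀ m, v m (G m) = μ m (G m) := fun m => if_pos rfl
  have hv0 : v m₀ k₀ = (1 + μ m₀ (G m₀)) / 2 := by simp [v, hk0]
  have hvo : ∀ m k, k ≠ G m → ¬ (m = m₀ ∧ k = k₀) → v m k = μ m (G m) / 2 := fun m k h1 h2 => by
    simp only [v, if_neg h1, if_neg h2]
  have hval : ∀ m, v m (Function.update G m₀ k₀ m) =
      if m = m₀ then (1 + μ m (G m) : ℝ) / 2 else μ m (G m) := fun m => by
    by_cases hm : m = m₀
    · subst hm
      simp [hv0]
    · simp [hm, hvG]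
  refine ⟨fun m k => ⟨v m k, hv m k⟩, Function.update G m₀ k₀,
    isUniqueOptimal_of_forall_lt ?_ ?_ ?_, ?_, ?_, ?_⟩
  · intro m m' hne
    by_cases hm : m = m₀
    · subst hm
      simpa [Function.update_of_ne hne] using hk₀ m'
    · rw [Function.update_of_ne hm]
      by_cases hm' : m' = m₀
      · subst hm'
        simpa using (hk₀ m).symm
      · simpa [Function.update_of_ne hm'] using hc m m' hne
  · intro m
    rw [← Subtype.coe_lt_coe]
    simp only [hval]
    have := hpos m
    split_ifs
    · change (0 : ℝ) < _
      linarith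
    · exact this
  · intro m k hk
    rw [← Subtype.coe_lt_coe]
    simp only [hval]
    have := hpos m
    by_cases hm : m = m₀
    · subst hm
      rw [if_pos rfl]
      simp only [Function.update_self] at hk
      by_cases hkG : k = G m
      · rw [hkG, hvG]
        linarith
      · rw [hvo m k hkG fun h => hk h.2]
        linarith
    · rw [if_neg hm]
      rw [Function.update_of_ne hm] at hk
      rw [hvo m k hk fun h => hm h.1]
      linarith
  · intro h
    exact hk0 (by rw [h]; simp)
  · intro m
    exact Subtype.ext (hvG m)
  · intro m k
    by_cases hkG : k = G m
    · subst hkG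
      exact Or.inl (Subtype.ext (hvG m))
    · right
      have := hpos m
      have := hle m
      by_cases hmk : m = m₀ ∧ k = k₀
      · obtain ⟨rfl, rfl⟩ := hmk
        simp only [hv0]
        constructor <;> linarith
      · simp only [hvo m k hkG hmk]
        constructor <;> linarith

/-! ### The lower bound -/

/-- The chord bound `x log (1 + s) ≤ log (1 + x s)` on `[0, 1]`. -/
theorem mul_log_one_add_le {x s : ℝ} (hx0 : 0 ≤ x) (hx1 : x ≤ 1) (hs : 0 ≤ s) :
    x * Real.log (1 + s) ≤ Real.log (1 + x * s) := by
  have h := strictConcaveOn_log_Ioi.concaveOn.2 (x := 1 + s) (y := 1)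
    (by simp only [Set.mem_Ioi]; linarith) (by simp) hx0 (sub_nonneg.2 hx1) (by ring)
  simp only [smul_eq_mul, Real.log_one, mul_zero, add_zero, mul_one] at h
  rwa [show x * (1 + s) + (1 - x) = 1 + x * s by ring] at h

theorem log_le_of_pullCount {μ ν : Instance M K} {G : Matching M K} {C : ℝ} (hC : 1 < C)
    (h : ∀ m, ν m (G m) = μ m (G m))
    (hle : ∀ x, (tableLaw μ x).toReal ≤ C * (tableLaw ν x).toReal)
    (π : Policy M K) {T : ℕ} (hT : 0 < T)
    (hν : expectation ν π T (fun y => (pullCount G y : ℝ)) ≤ (T : ℝ) ^ (1 / 2 : ℝ))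
    {B : ℝ} (hB : (T : ℝ) - mean (historyLaw μ π T T) (fun y => (pullCount G y : ℝ)) ≤ B)
    (hBT : B ≤ T / 2) :
    Real.log T / 4 ≤ Real.log 2 + Real.log C * (B + hintComplexity μ π T) := by
  have hT' : (0 : ℝ) < T := by exact_mod_cast hT
  set s : ℝ := (T : ℝ) ^ (1 / 2 : ℝ) with hs
  have hs0 : 0 < s := Real.rpow_pos_of_pos hT' _
  have hss : s * s = T := by
    rw [hs, ← Real.rpow_add hT']
    norm_num
  have hlogs : Real.log s = Real.log T / 2 := by rw [hs, Real.log_rpow hT']; ring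
  set n : ℝ := mean (historyLaw μ π T T) (fun y => (pullCount G y : ℝ)) with hn
  have hmain := mean_log_historyLaw_le hC h hle π T T (fun y => 1 + s⁻¹ * (pullCount G y : ℝ))
    fun y => by positivity
  have hcost : mean (historyLaw μ π T T) (fun y => (historyCost G y : ℝ)) =
      T - n + hintComplexity μ π T := by
    have : ∀ y : History M K T, (historyCost G y : ℝ) =
        (T + (-1) * pullCount G y) + hintCount y := fun y => by rw [historyCost_eq]; ring
    simp only [this, mean_add, mean_const, mean_const_mul, hintComplexity, expectation_eq_mean]
    ring
  have hupper : Real.log (mean (historyLaw ν π T T) fun y => 1 + s⁻¹ * (pullCount G y : ℝ)) ≤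
      Real.log 2 := by
    refine Real.log_le_log (mean_pos _ fun y => by positivity) ?_
    rw [mean_add, mean_const, mean_const_mul]
    rw [expectation_eq_mean] at hν
    have : s⁻¹ * mean (historyLaw ν π T T) (fun y => (pullCount G y : ℝ)) ≤ 1 := by
      rw [inv_mul_le_iff₀ hs0, mul_one]
      exact hν
    linarith
  -- Chord bound at `x = pullCount / T`; here `x * s = pullCount / s` because `s * s = T`.
  have hlower : Real.log (1 + s) / T * n ≤
      mean (historyLaw μ π T T) fun y => Real.log (1 + s⁻¹ * (pullCount G y : ℝ)) := by
    rw [hn, ← mean_const_mul]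
    refine mean_mono _ fun y => ?_
    have hy : (pullCount G y : ℝ) / T ≤ 1 := by
      rw [div_le_one hT']
      exact_mod_cast pullCount_le G y
    refine le_trans (le_of_eq (by ring))
      ((mul_log_one_add_le (by positivity) hy hs0.le).trans_eq ?_)
    congr 2
    rw [← hss]
    field_simp
  have hlog1 : 0 ≤ Real.log (1 + s) := Real.log_nonneg (by linarith)
  have hlog2 : Real.log T / 2 ≤ Real.log (1 + s) := by
    rw [← hlogs]
    exact Real.log_le_log hs0 (by linarith)
  -- `hB` and `hBT` give `n ≥ T / 2`.
  have hhalf : Real.log (1 + s) / 2 ≤ Real.log (1 + s) / T * n := by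
    rw [div_mul_eq_mul_div, le_div_iff₀ hT']
    nlinarith
  have hfin : Real.log C * (T - n + hintComplexity μ π T) ≤
      Real.log C * (B + hintComplexity μ π T) :=
    mul_le_mul_of_nonneg_left (by linarith) (Real.log_pos hC).le
  rw [hcost] at hmain
  linarith

end HMA2B

theorem mainTheorem6 (M K : ℕ) (hM : 0 < M) (hMK : M < K)
    (π : HMA2B.Policy M K) (hπ : HMA2B.UniformlyFastConvergent π)
    (μ : HMA2B.Instance M K) (Gstar : HMA2B.Matching M K)
    (hG : HMA2B.IsUniqueOptimal μ Gstar) (hU : HMA2B.utility μ Gstar < M)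
    (hR : HMA2B.TimeIndependentRegret μ Gstar π) :
    ∃ c : ℝ, 0 < c ∧
      ∀ᶠ T : ℕ in Filter.atTop, c * Real.log T ≤ HMA2B.hintComplexity μ π T := by
  obtain ⟨ν, G', hG', hne, hag, hreg⟩ := HMA2B.exists_confusing_instance hMK hG hU
  obtain ⟨C, hC, hle⟩ := HMA2B.exists_le_mul_of_support_subset (HMA2B.tableLaw μ)
    (HMA2B.tableLaw ν) (HMA2B.tableLaw_eq_zero_of_eq_zero hreg)
  obtain ⟨Δ, hΔ, hgap⟩ := HMA2B.exists_gap hG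
  obtain ⟨R, hR⟩ := hR
  have hlogC : 0 < Real.log C := Real.log_pos hC
  have hν := (hπ ν G' hG' (1 / 2) (by norm_num) (by norm_num) Gstar hne).bound one_pos
  have hlogT : Filter.Tendsto (fun T : ℕ => Real.log T) Filter.atTop Filter.atTop :=
    Real.tendsto_log_atTop.comp tendsto_natCast_atTop_atTop
  -- Half of `log T / 4` absorbs the constant terms, leaving `log T / 8`.
  refine ⟨1 / (8 * Real.log C), by positivity, ?_⟩
  filter_upwards [hν, Filter.eventually_gt_atTop 0,
    tendsto_natCast_atTop_atTop.eventually_ge_atTop (2 * (R / Δ)),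
    hlogT.eventually_ge_atTop (8 * (Real.log 2 + Real.log C * (R / Δ)))] with T h1 h2 h3 h4
  have hB := (HMA2B.gap_mul_le_regret hgap π T).trans (hR T)
  have h1' : HMA2B.expectation ν π T (fun y => (HMA2B.pullCount Gstar y : ℝ)) ≤
      (T : ℝ) ^ (1 / 2 : ℝ) := by
    refine (le_abs_self _).trans (h1.trans_eq ?_)
    rw [one_mul, Real.norm_of_nonneg (by positivity)]
  have h5 := HMA2B.log_le_of_pullCount hC hag hle π h2 h1' (B := R / Δ)
    ((le_div_iff₀' hΔ).2 hB) (by linarith)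
  rw [div_mul_eq_mul_div, one_mul, div_le_iff₀ (by positivity)]
  linarith
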